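/- Let $R$ be an algebraically closed field and let $G$ be a locally profinite group (a Hausdorff, locally compact, totally disconnected topological group) with center $Z$. A compact group $K$ is said to have invertible pro-order in $R$ if the index $[K:U]$ is invertible in $R$ for every open subgroup $U$ of $K$. Assume that $G$ has a compact open subgroup of invertible pro-order in $R$. Let $N$ be a closed subgroup of $G$ which is exhausted by compact subgroups of invertible pro-order in $R$, i.e. $N$ is the union of a family, directed under inclusion, of such subgroups, and let $\theta : N \to R^\times$ be a smooth character (a homomorphism with open kernel). For a smooth representation $\pi$ of $G$ on an $R$-vector space $V$ (every vector has open stabilizer), let $\pi^\vee$ be its contragredient, i.e. the representation of $G$ on the space $V^\vee$ of smooth vectors in the full linear dual of $V$. For a smooth character $\chi$ of $N$ put $d_\chi(\pi) = \dim_R \operatorname{Hom}_N(\pi,\chi)$, where $\operatorname{Hom}_N(\pi,\chi)$ is the space of linear forms $T : V \to R$ with $T(\pi(n)v) = \chi(n)T(v)$ for all $n \in N$, $v \in V$. The representation $\pi$ is called $Z$-compact if each of its matrix coefficients $g \mapsto v^\vee(\pi(g)v)$, $v^\vee \in V^\vee$, $v \in V$, has compact support modulo $Z$, i.e. support contained in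 $ZC$ for some compact subset $C$ of $G$. Let $\pi$ be an irreducible $Z$-compact smooth $R$-representation of $G$. Then $d_{\theta^{-1}}(\pi^\vee)$ is finite if and only if $d_\theta(\pi)$ is finite, and in that case $$d_{\theta^{-1}}(\pi^\vee) = d_\theta(\pi).$$ -/

import Mathlib

open scoped Pointwise

namespace LocProf

section Groups

variable (R : Type*) [CommRing R] {G : Type*} [Group G] [TopologicalSpace G]

/-- The pro-order of a compact subgroup `K` is the least common multiple (a supernatural number)
of the indices `[K : U]`, for `U` an open subgroup of `K`. It is invertible in `R` when each of
these indices is. -/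
def HasInvertibleProOrder (K : Subgroup G) : Prop :=
  ∀ U : Subgroup K, IsOpen (U : Set K) → IsUnit (U.index : R)

/-- `N` is exhausted by compact subgroups of invertible pro-order in `R`: it is the union of a
family, directed under inclusion, of such subgroups. -/
def IsExhausted (N : Subgroup G) : Prop :=
  ∃ 𝓚 : Set (Subgroup G),
    DirectedOn (· ≤ ·) 𝓚 ∧
    (∀ K ∈ 𝓚, IsCompact (K : Set G) ∧ HasInvertibleProOrder R K) ∧
    (N : Set G) = ⋃ K ∈ 𝓚, (K : Set G)

/-- A set is compact modulo the center `Z` if it is contained in `Z * C` for a compact `C`. -/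
def IsCompactModCenter (S : Set G) : Prop :=
  ∃ C : Set G, IsCompact C ∧ S ⊆ (Subgroup.center G : Set G) * C

end Groups

section Representations

variable {R : Type*} [CommRing R] {G : Type*} [Group G]
  {V : Type*} [AddCommGroup V] [Module R V]

/-- The stabilizer in `G` of a vector `v` of a representation. -/
def vecStabilizer (π : Representation R G V) (v : V) : Subgroup G where
  carrier := {g | π g v = v}
  one_mem' := by simp
  mul_mem' {a b} ha hb := by
    change π a v = v at ha
    change π b v = v at hb
    change π (a * b) v = v
    rw [map_mul, Module.End.mul_apply, hb, ha]
  inv_mem' {a} ha := by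
    change π a v = v at ha
    change π a⁻¹ v = v
    rw [Representation.inv_apply_eq_iff, ha]

theorem mem_vecStabilizer {π : Representation R G V} {v : V} {g : G} :
    g ∈ vecStabilizer π v ↔ π g v = v := Iff.rfl

/-- The one-dimensional representation on `R` given by a character `θ`. -/
def charRep (θ : G →* Rˣ) : Representation R G R where
  toFun g := LinearMap.lsmul R R (θ g : R)
  map_one' := by ext; simp
  map_mul' a b := by ext; simp

/-- `Hom_N(π, θ)`, for a representation `π` of `G` and a character `θ` of a subgroup `N`: the
`R`-module of `N`-equivariant linear maps from (the restriction of) `π` to `θ`. -/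
abbrev HomChar {V : Type*} [AddCommMonoid V] [Module R V]
    (π : Representation R G V) (N : Subgroup G) (θ : N →* Rˣ) : Type _ :=
  Representation.IntertwiningMap (π.comp N.subtype : Representation R N V) (charRep θ)

/-- A character is smooth if its kernel is open. -/
def IsSmoothChar [TopologicalSpace G] (θ : G →* Rˣ) : Prop :=
  IsOpen (θ.ker : Set G)

variable [TopologicalSpace G]

/-- A representation is smooth if the stabilizer of each vector is open. -/
def IsSmooth (π : Representation R G V) : Prop :=
  ∀ v : V, IsOpen (vecStabilizer π v : Set G)

variable [IsTopologicalGroup G]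

/-- The subrepresentation of smooth vectors, i.e. of the vectors with open stabilizer. -/
def smoothVectors (π : Representation R G V) : Subrepresentation π where
  toSubmodule :=
    { carrier := {v | IsOpen (vecStabilizer π v : Set G)}
      zero_mem' := by
        have h : vecStabilizer π (0 : V) = ⊤ := by
          ext g
          simp [mem_vecStabilizer]
        change IsOpen (vecStabilizer π (0 : V) : Set G)
        rw [h]
        exact isOpen_univ
      add_mem' := by
        intro v w hv hw
        refine Subgroup.isOpen_mono (H₁ := vecStabilizer π v ⊓ vecStabilizer π w) ?_
          (IsOpen.inter hv hw)
        rintro g ⟨h1, h2⟩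
        change π g v = v at h1
        change π g w = w at h2
        change π g (v + w) = v + w
        rw [map_add, h1, h2]
      smul_mem' := by
        intro c v hv
        refine Subgroup.isOpen_mono (H₁ := vecStabilizer π v) ?_ hv
        intro g h1
        change π g v = v at h1
        change π g (c • v) = c • v
        rw [map_smul, h1] }
  apply_mem_toSubmodule := by
    intro g v hv
    change IsOpen (vecStabilizer π v : Set G) at hv
    change IsOpen (vecStabilizer π (π g v) : Set G)
    have key : (vecStabilizer π (π g v) : Set G) =
        (fun h : G => g⁻¹ * h * g) ⁻¹' (vecStabilizer π v : Set G) := by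
      ext h
      simp only [Set.mem_preimage, SetLike.mem_coe, mem_vecStabilizer, map_mul,
        Module.End.mul_apply, Representation.inv_apply_eq_iff]
    rw [key]
    exact hv.preimage (by fun_prop)

/-- The space of the contragredient `π^∨`: the smooth vectors in the full linear dual of `π`. -/
abbrev SmoothDual (π : Representation R G V) : Type _ :=
  (smoothVectors π.dual).toSubmodule

/-- The contragredient representation `π^∨` of `π`, on the smooth linear dual. -/
def contragredient (π : Representation R G V) : Representation R G (SmoothDual π) :=
  (smoothVectors π.dual).toRepresentation

/-- The matrix coefficient `g ↦ ⟨v^∨, π(g) v⟩` of `π`. -/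
def matrixCoeff (π : Representation R G V) (f : SmoothDual π) (v : V) : G → R :=
  fun g => (f : Module.Dual R V) (π g v)

/-- `π` is `Z`-compact: all its matrix coefficients have compact support modulo the center. -/
def IsZCompact (π : Representation R G V) : Prop :=
  ∀ (f : SmoothDual π) (v : V), IsCompactModCenter (Function.support (matrixCoeff π f v))

end Representations

end LocProf

/-! Integrate over N. For f in V^∨ and v in V, the integral I(f, v) of θ(n)⁻¹ f(π(n)v) over N is
θ-equivariant in v, so f ↦ I(f, ·) maps V^∨ to Hom_N(π, θ). The crux (`homChar_apply_eq_zero`) is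
that every T in Hom_N(π^∨, θ⁻¹) kills the kernel of this map. If I(f, ·) = 0, then the θ-twisted
mean of f over a large subgroup L from the exhaustion of N vanishes on the whole orbit of some v₀ ≠
0, Z-compactness allowing one L for the orbit. So the mean is 0, and T(f), which equals T of the
mean, is 0. Hence Hom_N(π^∨, θ⁻¹) embeds in the dual of a space of dimension at most d_θ(π)
(`finrank_homChar_le`). Exchanging π and π^∨ gives the other inequality.

The integral is the eventual value of [L : L ∩ M] times the mean over L, where M = N ∩ ZJ with J
compact open. It makes sense when π(z) is the scalar θ(n) for all n = zj in N with z ∈ Z, j ∈ J. If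
no open J has this property, then for small J the offending z still act by scalars, because a power
of n fixes a nonzero vector and R is algebraically closed. Scalars different from θ(n), for J
arbitrarily small, force both Hom spaces to vanish (`subsingleton_homChar`). -/

namespace LocProf

/-! ### Means of locally constant functions -/

section Mean

variable {K : Type*} [Group K] {X : Type*}

/-- The subgroup of the right periods of a function on a group. -/
def rightPeriods (φ : K → X) : Subgroup K where
  carrier := {u | ∀ k, φ (k * u) = φ k}
  one_mem' := by simp
  mul_mem' {a b} ha hb k := by rw [← mul_assoc, hb, ha]
  inv_mem' {a} ha k := by rw [← ha (k * a⁻¹), inv_mul_cancel_right]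

theorem apply_out_eq {φ : K → X} {U : Subgroup K} (h : U ≤ rightPeriods φ) (k : K) :
    φ ((k : K ⧸ U).out) = φ k := by
  obtain ⟨u, hu⟩ := QuotientGroup.mk_out_eq_mul U k
  rw [hu]
  exact h u.2 k

variable [AddCommGroup X]

/-- Each coset of `U'` splits into `U.relIndex U'` cosets of `U`, on which `φ` takes one value. This
makes the mean independent of the subgroup used to compute it. -/
theorem finsum_out_eq_relIndex_smul {φ : K → X} {U U' : Subgroup K} [U.FiniteIndex]
    (hle : U ≤ U') (h : U' ≤ rightPeriods φ) :
    ∑ᶠ q : K ⧸ U, φ q.out = U.relIndex U' • ∑ᶠ q : K ⧸ U', φ q.out := by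
  have : U'.FiniteIndex := Subgroup.finiteIndex_of_le hle
  have : Fintype (K ⧸ U) := Fintype.ofFinite _
  have : Fintype (K ⧸ U') := Fintype.ofFinite _
  have : Fintype (U' ⧸ U.subgroupOf U') := Fintype.ofFinite _
  rw [finsum_eq_sum_of_fintype, finsum_eq_sum_of_fintype,
    ← (Subgroup.quotientEquivProdOfLE hle).symm.sum_comp, Fintype.sum_prod_type, Finset.smul_sum]
  refine Finset.sum_congr rfl fun q _ => ?_
  have key : ∀ b : U' ⧸ U.subgroupOf U',
      φ ((Subgroup.quotientEquivProdOfLE hle).symm (q, b)).out = φ q.out := by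
    intro b
    obtain ⟨t, rfl⟩ := QuotientGroup.mk_surjective b
    change φ ((q.out * t : K) : K ⧸ U).out = φ q.out
    rw [apply_out_eq (hle.trans h)]
    exact h t.2 _
  rw [Finset.sum_congr rfl fun b _ => key b, Finset.sum_const, Finset.card_univ,
    Subgroup.relIndex, Subgroup.index, Nat.card_eq_fintype_card]

variable (R : Type*) [Field R] [Module R X]

/-- The mean of a locally constant function on a compact group, computed on the cosets of its
group of right periods. -/
noncomputable def groupMean (φ : K → X) : X :=
  ((rightPeriods φ).index : R)⁻¹ • ∑ᶠ q : K ⧸ rightPeriods φ, φ q.out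

variable {R}

theorem finiteIndex_of_cast_ne_zero {U : Subgroup K} (hU : (U.index : R) ≠ 0) : U.FiniteIndex :=
  ⟨fun h => hU (by simp [h])⟩

theorem groupMean_eq {φ : K → X} {U : Subgroup K} (hU : (U.index : R) ≠ 0)
    (h : U ≤ rightPeriods φ) :
    groupMean R φ = (U.index : R)⁻¹ • ∑ᶠ q : K ⧸ U, φ q.out := by
  have := finiteIndex_of_cast_ne_zero hU
  rw [finsum_out_eq_relIndex_smul h le_rfl, groupMean]
  have hm := Subgroup.relIndex_mul_index h
  rw [← hm] at hU ⊢
  push_cast at hU ⊢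
  rw [← Nat.cast_smul_eq_nsmul R, smul_smul, mul_inv, mul_right_comm,
    inv_mul_cancel₀ (left_ne_zero_of_mul hU), one_mul]

theorem groupMean_add {φ ψ : K → X} {U : Subgroup K} (hU : (U.index : R) ≠ 0)
    (h : U ≤ rightPeriods φ) (h' : U ≤ rightPeriods ψ) :
    groupMean R (fun k => φ k + ψ k) = groupMean R φ + groupMean R ψ := by
  have := finiteIndex_of_cast_ne_zero hU
  rw [groupMean_eq hU h, groupMean_eq hU h', groupMean_eq (φ := fun k => φ k + ψ k) hU
    (fun u hu k => congrArg₂ (· + ·) (h hu k) (h' hu k)), finsum_add_distrib (Set.toFinite _) (Set.toFinite _),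
    smul_add]

theorem map_groupMean {Y : Type*} [AddCommGroup Y] [Module R Y] (T : X →ₗ[R] Y)
    {φ : K → X} {U : Subgroup K} (hU : (U.index : R) ≠ 0) (h : U ≤ rightPeriods φ) :
    groupMean R (fun k => T (φ k)) = T (groupMean R φ) := by
  have := finiteIndex_of_cast_ne_zero hU
  rw [groupMean_eq hU h, groupMean_eq (φ := fun k => T (φ k)) hU (fun u hu k => congrArg T (h hu k)),
    map_smul]
  congr 1
  exact ((T : X →+ Y).map_finsum (Set.toFinite _)).symm

theorem groupMean_const (x : X) :
    groupMean R (fun _ : K => x) = x := by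
  have hr : rightPeriods (fun _ : K => x) = ⊤ := by ext; simp [rightPeriods]
  rw [groupMean_eq (U := ⊤) (by simp) hr.ge]
  have := QuotientGroup.subsingleton_quotient_top (G := K)
  have : Unique (K ⧸ (⊤ : Subgroup K)) := Unique.mk' _
  simp [finsum_unique]

/-- Normality keeps `U` among the periods of the translate and lets `a` permute `K ⧸ U`. -/
theorem groupMean_mul_right {φ : K → X} {U : Subgroup K} [U.Normal] (hU : (U.index : R) ≠ 0)
    (h : U ≤ rightPeriods φ) (a : K) :
    groupMean R (fun k => φ (k * a)) = groupMean R φ := by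
  have h' : U ≤ rightPeriods (fun k => φ (k * a)) := fun u hu k => by
    have := h (Subgroup.Normal.conj_mem' ‹_› u hu a) (k * a)
    simpa [mul_assoc] using this
  rw [groupMean_eq hU h, groupMean_eq hU h',
    ← finsum_comp_equiv (Equiv.mulRight (a : K ⧸ U)) (f := fun q : K ⧸ U => φ q.out)]
  congr 2 with q
  obtain ⟨k, rfl⟩ := QuotientGroup.mk_surjective q
  rw [apply_out_eq h' k]
  exact (apply_out_eq h (k * a)).symm

theorem groupMean_inv {φ : K → X} {U : Subgroup K} [U.Normal] (hU : (U.index : R) ≠ 0)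
    (h : U ≤ rightPeriods φ) :
    groupMean R (fun k => φ k⁻¹) = groupMean R φ := by
  have h' : U ≤ rightPeriods (fun k => φ k⁻¹) := fun u hu k => by
    have := h (Subgroup.Normal.conj_mem ‹_› _ (U.inv_mem hu) k) k⁻¹
    simpa [mul_assoc] using this
  rw [groupMean_eq hU h, groupMean_eq hU h', ← finsum_comp_equiv (Equiv.inv (K ⧸ U)) (f := fun q : K ⧸ U => φ q.out)]
  congr 2 with q
  obtain ⟨k, rfl⟩ := QuotientGroup.mk_surjective q
  rw [apply_out_eq h' k, Equiv.inv_apply, ← QuotientGroup.mk_inv, apply_out_eq h]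

end Mean

/-! ### Invertible pro-order and open subgroups -/

section ProOrder

variable {R : Type*} [Field R] {G : Type*} [Group G] [TopologicalSpace G]

theorem HasInvertibleProOrder.index_ne_zero {K : Subgroup G} (hK : HasInvertibleProOrder R K)
    {U : Subgroup G} (hU : IsOpen (U : Set G)) : ((U.subgroupOf K).index : R) ≠ 0 :=
  (hK _ (hU.preimage continuous_subtype_val)).ne_zero

/-- Inside a subgroup of invertible pro-order, each open subgroup contains a normal one of
invertible index. -/
theorem HasInvertibleProOrder.exists_normal [IsTopologicalGroup G] {K : Subgroup G}
    (hK : HasInvertibleProOrder R K) {U : Subgroup G} (hU : IsOpen (U : Set G)) :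
    ∃ U' : Subgroup K, U'.Normal ∧ (U'.index : R) ≠ 0 ∧ U' ≤ U.subgroupOf K := by
  have ho : IsOpen (U.subgroupOf K : Set K) := hU.preimage continuous_subtype_val
  have := finiteIndex_of_cast_ne_zero (hK.index_ne_zero hU)
  refine ⟨(U.subgroupOf K).normalCore, inferInstance, ?_, Subgroup.normalCore_le _⟩
  exact (hK _ (Subgroup.isOpen_of_isClosed_of_finiteIndex _
    (Subgroup.normalCore_isClosed _ (Subgroup.isClosed_of_isOpen _ ho)))).ne_zero

theorem relIndex_ne_zero_of_isOpen [IsTopologicalGroup G] {J U : Subgroup G}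
    (hJ : IsCompact (J : Set G)) (hU : IsOpen (U : Set G)) : U.relIndex J ≠ 0 := by
  have : CompactSpace J := isCompact_iff_compactSpace.1 hJ
  have := Subgroup.quotient_finite_of_isOpen (U.subgroupOf J) (hU.preimage continuous_subtype_val)
  exact (Subgroup.finiteIndex_of_finite_quotient (H := U.subgroupOf J)).index_ne_zero

/-- Invertibility of the pro-order passes to open subgroups of compact groups. -/
theorem HasInvertibleProOrder.of_le_of_isOpen [IsTopologicalGroup G] {J K : Subgroup G}
    (hK : HasInvertibleProOrder R K) (hle : J ≤ K) (hJ : IsOpen (J : Set G)) :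
    HasInvertibleProOrder R J := by
  intro U hU
  have ho : IsOpen ((U.map J.subtype : Subgroup G) : Set G) := by
    rw [Subgroup.coe_map]
    exact hJ.isOpenMap_subtype_val _ hU
  have h1 := hK.index_ne_zero ho
  have h2 := Subgroup.relIndex_mul_relIndex _ J K (Subgroup.map_subtype_le U) hle
  have h3 : (U.map J.subtype).relIndex J = U.index := by
    rw [Subgroup.relIndex, Subgroup.subgroupOf,
      Subgroup.comap_map_eq_self_of_injective J.subtype_injective]
  rw [h3] at h2
  change (((U.map J.subtype).relIndex K : ℕ) : R) ≠ 0 at h1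
  rw [← h2] at h1
  push_cast at h1
  exact (left_ne_zero_of_mul h1).isUnit

end ProOrder

open Filter

/-! ### Cosets and sums along a directed exhaustion -/

section Directed

variable {N : Type*} [Group N] {𝓛 : Set (Subgroup N)}

theorem eventually_mem_of_cover (hcov : ∀ n : N, ∃ L ∈ 𝓛, n ∈ L) (n : N) :
    ∀ᶠ L : 𝓛 in atTop, n ∈ (L : Subgroup N) := by
  obtain ⟨L, hL, hn⟩ := hcov n
  exact (eventually_ge_atTop (⟨L, hL⟩ : 𝓛)).mono fun L' h => h hn

theorem finite_preimage_quotient {M U : Subgroup N} (hU : U ≤ M) (hi : U.relIndex M ≠ 0)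
    {A : Set (N ⧸ M)} (hA : A.Finite) : {q : N ⧸ U | ((q.out : N) : N ⧸ M) ∈ A}.Finite := by
  have : (U.subgroupOf M).FiniteIndex := ⟨hi⟩
  have hf := (hA.prod (Set.finite_univ (α := M ⧸ U.subgroupOf M))).preimage
    (Subgroup.quotientEquivProdOfLE hU).injective.injOn
  refine hf.subset fun q hq => ⟨?_, trivial⟩
  have h : ((Subgroup.quotientEquivProdOfLE hU) ((q.out : N) : N ⧸ U)).1 = ((q.out : N) : N ⧸ M) :=
    rfl
  rw [QuotientGroup.out_eq'] at h
  rwa [h]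

/-- Serves to factor [L : L ∩ U] as [M : U] [L : L ∩ M] once `L` contains representatives of `M /
U`. -/
theorem relIndex_inf_eq_of_out_mem {M U L : Subgroup N} (hU : U ≤ M)
    (h : ∀ q : N ⧸ U, q.out ∈ M → q.out ∈ L) : U.relIndex (M ⊓ L) = U.relIndex M := by
  refine Nat.card_congr (Equiv.ofBijective
    (Subgroup.quotientSubgroupOfEmbeddingOfLE U (inf_le_left : M ⊓ L ≤ M))
    ⟨(Subgroup.quotientSubgroupOfEmbeddingOfLE U _).injective, fun q => ?_⟩)
  obtain ⟨m, rfl⟩ := QuotientGroup.mk_surjective q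
  obtain ⟨u, hu⟩ := QuotientGroup.mk_out_eq_mul U (m : N)
  have hM : ((m : N) : N ⧸ U).out ∈ M := by
    rw [hu]
    exact M.mul_mem m.2 (hU u.2)
  refine ⟨((⟨_, hM, h _ hM⟩ : (M ⊓ L : Subgroup N)) : _ ⧸ U.subgroupOf (M ⊓ L)), ?_⟩
  change (((⟨_, hM⟩ : M)) : M ⧸ U.subgroupOf M) = m
  rw [QuotientGroup.eq, Subgroup.mem_subgroupOf]
  simp [hu]

/-- The sum over `N / U` of a function supported on a subgroup `L` is a sum over `L / (L ∩ U)`. -/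
theorem finsum_quotient_eq {X : Type*} [AddCommGroup X] {U L : Subgroup N} {φ : N → X}
    (hφ : U ≤ rightPeriods φ) (h : ∀ q : N ⧸ U, φ q.out ≠ 0 → q.out ∈ L) :
    ∑ᶠ q : L ⧸ U.subgroupOf L, φ q.out = ∑ᶠ q : N ⧸ U, φ q.out := by
  let ι : L ⧸ U.subgroupOf L → N ⧸ U := Quotient.map' Subtype.val fun a b hab => by
    rw [QuotientGroup.leftRel_apply] at hab ⊢
    exact hab
  have hι : Function.Injective ι := by
    intro a b
    obtain ⟨a, rfl⟩ := QuotientGroup.mk_surjective a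
    obtain ⟨b, rfl⟩ := QuotientGroup.mk_surjective b
    intro hab
    rw [QuotientGroup.eq, Subgroup.mem_subgroupOf]
    exact (QuotientGroup.eq (s := U)).1 hab
  have h1 : ∀ q : L ⧸ U.subgroupOf L, φ q.out = φ (ι q).out := by
    intro q
    obtain ⟨k, rfl⟩ := QuotientGroup.mk_surjective q
    change _ = φ ((k : N) : N ⧸ U).out
    rw [apply_out_eq hφ]
    exact apply_out_eq (φ := fun l : L => φ l) (fun u hu l => hφ hu l) k
  have h2 : Function.support (fun q : N ⧸ U => φ q.out) ⊆ Set.range ι := by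
    intro q hq
    exact ⟨((⟨q.out, h q hq⟩ : L) : L ⧸ U.subgroupOf L), QuotientGroup.out_eq' q⟩
  rw [finsum_congr h1, ← finsum_mem_range (f := fun q : N ⧸ U => φ q.out) hι]
  rw [← finsum_mem_univ fun q : N ⧸ U => φ q.out]
  exact finsum_mem_inter_support_eq _ _ _ (by rw [Set.inter_eq_right.2 h2, Set.univ_inter])

end Directed

/-! ### Integrals of matrix coefficients as eventual means -/

section Integral

variable {R : Type*} [Field R] {N : Type*} [Group N]
  {V : Type*} [AddCommGroup V] [Module R V] {W : Type*} [AddCommGroup W] [Module R W]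
  (ρ : Representation R N V) (β : W →ₗ[R] V →ₗ[R] R)

/-- The mean over a subgroup `L` of a matrix coefficient. -/
noncomputable def coeffMean (L : Subgroup N) (w : W) (v : V) : R :=
  groupMean R fun l : L => β w (ρ l v)

/-- The integral over `N` of a matrix coefficient, for the Haar measure on `N` giving volume `1`
to `M`. -/
noncomputable def coeffIntegral (M : Subgroup N) (w : W) (v : V) : R :=
  (((M ⊓ vecStabilizer ρ v).relIndex M : ℕ) : R)⁻¹ *
    ∑ᶠ q : N ⧸ (M ⊓ vecStabilizer ρ v), β w (ρ q.out v)

variable {ρ β}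

theorem le_rightPeriods_coeff {U : Subgroup N} {v : V} (h : U ≤ vecStabilizer ρ v) (w : W) :
    U ≤ rightPeriods fun n => β w (ρ n v) := by
  intro u hu n
  have : ρ u v = v := h hu
  simp [map_mul, this]

theorem le_rightPeriods_coeff_subgroup {L : Subgroup N} {U : Subgroup L} {v : V}
    (h : U ≤ (vecStabilizer ρ v).subgroupOf L) (w : W) :
    U ≤ rightPeriods fun l : L => β w (ρ l v) := fun _ hu l =>
  le_rightPeriods_coeff le_rfl w (h hu) l

variable [TopologicalSpace N] {𝓛 : Set (Subgroup N)}

/-- Only finitely many cosets of `U` lie over `D` or in `M`; once `L` contains their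
representatives, both sides are the same finite sum up to normalization. The choice of `L` depends
on `D` but not on `w`, so that it can serve all central translates of a vector. -/
theorem eventually_coeffMean (hcov : ∀ n : N, ∃ L ∈ 𝓛, n ∈ L)
    (hpro : ∀ L ∈ 𝓛, HasInvertibleProOrder R L) {M : Subgroup N} (hM : IsOpen (M : Set N))
    {v : V} (hv : IsOpen (vecStabilizer ρ v : Set N)) (hMv : (vecStabilizer ρ v).relIndex M ≠ 0)
    {D : Set N} (hD : ((↑) '' D : Set (N ⧸ M)).Finite) :
    ∀ᶠ L : 𝓛 in atTop, ∀ w : W, {n | β w (ρ n v) ≠ 0} ⊆ D →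
      (M.relIndex (L : Subgroup N) : R) * coeffMean ρ β L w v = coeffIntegral ρ β M w v := by
  set U := M ⊓ vecStabilizer ρ v with hUdef
  have hUM : U ≤ M := inf_le_left
  have hi : U.relIndex M ≠ 0 := by rwa [hUdef, Subgroup.inf_relIndex_left]
  have hf := finite_preimage_quotient hUM hi (hD.union (Set.finite_singleton ((1 : N) : N ⧸ M)))
  have hev : ∀ᶠ L : 𝓛 in atTop, ∀ q ∈ {q : N ⧸ U | ((q.out : N) : N ⧸ M) ∈
      (↑) '' D ∪ {((1 : N) : N ⧸ M)}}, q.out ∈ (L : Subgroup N) :=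
    (eventually_all_finite hf).2 fun q _ => eventually_mem_of_cover hcov _
  filter_upwards [hev] with L hL w hw
  have hUo : IsOpen (U : Set N) := hM.inter hv
  have hne : (U.relIndex (L : Subgroup N) : R) ≠ 0 := (hpro L L.2).index_ne_zero hUo
  have hidx : U.relIndex (L : Subgroup N) = U.relIndex M * M.relIndex (L : Subgroup N) := by
    rw [← relIndex_inf_eq_of_out_mem (L := L) hUM, Subgroup.relIndex_inf_mul_relIndex,
      inf_eq_left.2 hUM]
    intro q hq
    refine hL q (Or.inr ?_)
    rw [Set.mem_singleton_iff, eq_comm, QuotientGroup.eq]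
    simpa using hq
  have hmean : coeffMean ρ β L w v =
      (U.relIndex (L : Subgroup N) : R)⁻¹ • ∑ᶠ q : N ⧸ U, β w (ρ q.out v) := by
    rw [coeffMean, groupMean_eq (U := U.subgroupOf L) hne
      (le_rightPeriods_coeff_subgroup (Subgroup.comap_mono inf_le_right) w)]
    congr 1
    refine finsum_quotient_eq (φ := fun n => β w (ρ n v))
      (le_rightPeriods_coeff inf_le_right w) fun q hq => hL q (Or.inl ⟨_, hw hq, rfl⟩)
  rw [hmean, coeffIntegral, ← hUdef, hidx, smul_eq_mul]
  -- The index of `U` in `M` is invertible in `R` because it divides the index of `L ∩ U` in `L`.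
  rw [hidx] at hne
  push_cast at hne ⊢
  rw [← mul_assoc]
  congr 1
  field_simp [left_ne_zero_of_mul hne, right_ne_zero_of_mul hne]

end Integral

open Filter

/-! ### Bilinearity and invariance of the means -/

section CoeffMean

variable {R : Type*} [Field R] {N : Type*} [Group N] [TopologicalSpace N]
  {V : Type*} [AddCommGroup V] [Module R V] {W : Type*} [AddCommGroup W] [Module R W]
  {ρ : Representation R N V} {σ : Representation R N W} {β : W →ₗ[R] V →ₗ[R] R}
  {L : Subgroup N} {v v' : V} {w w' : W}

theorem coeffMean_add_left (hL : HasInvertibleProOrder R L)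
    (hv : IsOpen (vecStabilizer ρ v : Set N)) :
    coeffMean ρ β L (w + w') v = coeffMean ρ β L w v + coeffMean ρ β L w' v := by
  simp only [coeffMean, map_add, LinearMap.add_apply]
  exact groupMean_add (hL.index_ne_zero hv) (le_rightPeriods_coeff_subgroup le_rfl w)
    (le_rightPeriods_coeff_subgroup le_rfl w')

theorem coeffMean_smul_left (hL : HasInvertibleProOrder R L)
    (hv : IsOpen (vecStabilizer ρ v : Set N)) (c : R) :
    coeffMean ρ β L (c • w) v = c * coeffMean ρ β L w v := by
  simp only [coeffMean, map_smul, LinearMap.smul_apply]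
  exact map_groupMean (LinearMap.lsmul R R c) (hL.index_ne_zero hv)
    (le_rightPeriods_coeff_subgroup le_rfl w)

theorem coeffMean_add_right (hL : HasInvertibleProOrder R L)
    (hv : IsOpen (vecStabilizer ρ v : Set N)) (hv' : IsOpen (vecStabilizer ρ v' : Set N)) :
    coeffMean ρ β L w (v + v') = coeffMean ρ β L w v + coeffMean ρ β L w v' := by
  simp only [coeffMean, map_add]
  exact groupMean_add (hL.index_ne_zero (U := vecStabilizer ρ v ⊓ vecStabilizer ρ v')
    (hv.inter hv')) (le_rightPeriods_coeff_subgroup (Subgroup.comap_mono inf_le_left) w)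
    (le_rightPeriods_coeff_subgroup (Subgroup.comap_mono inf_le_right) w)

theorem coeffMean_smul_right (hL : HasInvertibleProOrder R L)
    (hv : IsOpen (vecStabilizer ρ v : Set N)) (c : R) :
    coeffMean ρ β L w (c • v) = c * coeffMean ρ β L w v := by
  simp only [coeffMean, map_smul]
  exact map_groupMean (LinearMap.lsmul R R c) (hL.index_ne_zero hv)
    (le_rightPeriods_coeff_subgroup le_rfl w)

variable [IsTopologicalGroup N]

theorem coeffMean_apply_right (hL : HasInvertibleProOrder R L)
    (hv : IsOpen (vecStabilizer ρ v : Set N)) {n : N} (hn : n ∈ L) :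
    coeffMean ρ β L w (ρ n v) = coeffMean ρ β L w v := by
  obtain ⟨U, hU, hi, hle⟩ := hL.exists_normal hv
  rw [coeffMean, coeffMean, ← groupMean_mul_right hi (le_rightPeriods_coeff_subgroup hle w) ⟨n, hn⟩]
  simp [map_mul]

/-- The substitution l ↦ l⁻¹ preserves means and moves the action from `v` to `w`. -/
theorem coeffMean_eq_apply_groupMean (hL : HasInvertibleProOrder R L)
    (hβ : ∀ n w v, β (σ n w) (ρ n v) = β w v)
    (hv : IsOpen (vecStabilizer ρ v : Set N)) (hw : IsOpen (vecStabilizer σ w : Set N)) :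
    coeffMean ρ β L w v = β (groupMean R fun l : L => σ l w) v := by
  obtain ⟨U, hU, hi, hle⟩ :=
    hL.exists_normal (U := vecStabilizer ρ v ⊓ vecStabilizer σ w) (hv.inter hw)
  have hp : U ≤ rightPeriods fun l : L => σ l w := by
    intro u hu l
    have : σ u w = w := (hle hu).2
    simp [map_mul, this]
  have hp' : U ≤ rightPeriods fun l : L => β w (ρ l v) :=
    le_rightPeriods_coeff_subgroup (hle.trans (Subgroup.comap_mono inf_le_left)) w
  rw [coeffMean, ← groupMean_inv hi hp']
  have h := map_groupMean (β.flip v) hi hp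
  rw [LinearMap.flip_apply] at h
  rw [← h]
  congr 1
  ext l
  rw [LinearMap.flip_apply, ← hβ l w]
  simp [← Module.End.mul_apply, ← map_mul]

end CoeffMean

/-! ### The invariant pairing given by integration -/

section Integral

variable {R : Type*} [Field R] {N : Type*} [Group N] [TopologicalSpace N]
  {V : Type*} [AddCommGroup V] [Module R V] {W : Type*} [AddCommGroup W] [Module R W]

/-- The conditions under which the matrix coefficients of `ρ` can be integrated over `N`, which is
exhausted by the subgroups in `𝓛`. -/
structure IsIntegrable (ρ : Representation R N V) (β : W →ₗ[R] V →ₗ[R] R) (M : Subgroup N)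
    (𝓛 : Set (Subgroup N)) : Prop where
  cover (n : N) : ∃ L ∈ 𝓛, n ∈ L
  proOrder : ∀ L ∈ 𝓛, HasInvertibleProOrder R L
  isOpen : IsOpen (M : Set N)
  smooth (v : V) : IsOpen (vecStabilizer ρ v : Set N)
  relIndex_ne_zero (v : V) : (vecStabilizer ρ v).relIndex M ≠ 0
  finite_support (w : W) (v : V) : ((↑) '' {n | β w (ρ n v) ≠ 0} : Set (N ⧸ M)).Finite

namespace IsIntegrable

variable {ρ : Representation R N V} {β : W →ₗ[R] V →ₗ[R] R} {M : Subgroup N}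
  {𝓛 : Set (Subgroup N)}

theorem eventually_eq (h : IsIntegrable ρ β M 𝓛) (w : W) (v : V) :
    ∀ᶠ L : 𝓛 in atTop,
      coeffIntegral ρ β M w v = (M.relIndex (L : Subgroup N) : R) * coeffMean ρ β L w v :=
  (eventually_coeffMean (β := β) h.cover h.proOrder h.isOpen (h.smooth v) (h.relIndex_ne_zero v)
    (h.finite_support w v)).mono fun _ hL => (hL w subset_rfl).symm

/-- The pairing given by integrating matrix coefficients over `N`. -/
noncomputable def integral [IsDirectedOrder 𝓛] [Nonempty 𝓛] (h : IsIntegrable ρ β M 𝓛) :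
    W →ₗ[R] V →ₗ[R] R :=
  LinearMap.mk₂ R (coeffIntegral ρ β M)
    (fun w w' v => by
      -- A single `L` is large enough for all the vectors involved, and the mean over it is
      -- bilinear.
      obtain ⟨L, ⟨h1, h2⟩, h3⟩ := (((h.eventually_eq (w + w') v).and (h.eventually_eq w v)).and
        (h.eventually_eq w' v)).exists
      rw [h1, h2, h3, coeffMean_add_left (h.proOrder L L.2) (h.smooth v), mul_add])
    (fun c w v => by
      obtain ⟨L, h1, h2⟩ := ((h.eventually_eq (c • w) v).and (h.eventually_eq w v)).exists
      rw [h1, h2, coeffMean_smul_left (h.proOrder L L.2) (h.smooth v), smul_eq_mul,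
        mul_left_comm])
    (fun w v v' => by
      obtain ⟨L, ⟨h1, h2⟩, h3⟩ := (((h.eventually_eq w (v + v')).and (h.eventually_eq w v)).and
        (h.eventually_eq w v')).exists
      rw [h1, h2, h3, coeffMean_add_right (h.proOrder L L.2) (h.smooth v) (h.smooth v'), mul_add])
    (fun c w v => by
      obtain ⟨L, h1, h2⟩ := ((h.eventually_eq w (c • v)).and (h.eventually_eq w v)).exists
      rw [h1, h2, coeffMean_smul_right (h.proOrder L L.2) (h.smooth v), smul_eq_mul,
        mul_left_comm])

theorem integral_apply [IsDirectedOrder 𝓛] [Nonempty 𝓛] (h : IsIntegrable ρ β M 𝓛)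
    (w : W) (v : V) : h.integral w v = coeffIntegral ρ β M w v := rfl

theorem integral_apply_right [IsTopologicalGroup N] [IsDirectedOrder 𝓛] [Nonempty 𝓛]
    (h : IsIntegrable ρ β M 𝓛) (w : W) (n : N) (v : V) :
    h.integral w (ρ n v) = h.integral w v := by
  obtain ⟨L, ⟨h1, h2⟩, h3⟩ := (((h.eventually_eq w (ρ n v)).and (h.eventually_eq w v)).and
    (eventually_mem_of_cover h.cover n)).exists
  rw [integral_apply, integral_apply, h1, h2,
    coeffMean_apply_right (h.proOrder L L.2) (h.smooth v) h3]

theorem eventually_coeffMean_eq_zero [IsDirectedOrder 𝓛] [Nonempty 𝓛]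
    (h : IsIntegrable ρ β M 𝓛) (v : V) {D : Set N} (hD : ((↑) '' D : Set (N ⧸ M)).Finite) :
    ∀ᶠ L : 𝓛 in atTop, ∀ w : W, {n | β w (ρ n v) ≠ 0} ⊆ D → h.integral w v = 0 →
      coeffMean ρ β L w v = 0 := by
  filter_upwards [eventually_coeffMean (β := β) h.cover h.proOrder h.isOpen (h.smooth v)
    (h.relIndex_ne_zero v) hD] with L hL w hw h0
  have := hL w hw
  rw [← h.integral_apply, h0] at this
  exact (mul_eq_zero.1 this).resolve_left ((h.proOrder L L.2).index_ne_zero h.isOpen)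

end IsIntegrable

end Integral

open Filter

/-! ### Twisting by a character -/

section Twist

variable {R : Type*} [Field R] {G : Type*} [Group G] {N : Subgroup G}
  {V : Type*} [AddCommGroup V] [Module R V]

/-- The restriction of a representation to a subgroup, twisted by a character. -/
def twist (π : Representation R G V) (χ : N →* Rˣ) : Representation R N V where
  toFun n := (χ n : R) • π n
  map_one' := by simp
  map_mul' a b := by
    ext v
    simp [smul_smul, mul_comm]

theorem twist_apply (π : Representation R G V) (χ : N →* Rˣ) (n : N) (v : V) :
    twist π χ n v = (χ n : R) • π n v := rfl

theorem apply_eq_smul_twist_inv (π : Representation R G V) (θ : N →* Rˣ) (n : N) (v : V) :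
    π n v = (θ n : R) • twist π θ⁻¹ n v := by
  simp [twist_apply, smul_smul]

theorem homChar_apply {π : Representation R G V} {θ : N →* Rˣ} (T : HomChar π N θ) (n : N)
    (v : V) : T (π n v) = (θ n : R) * T v :=
  Representation.IntertwiningMap.isIntertwining (π.comp N.subtype) (charRep θ) T n v

theorem isOpen_vecStabilizer_twist [TopologicalSpace G] [IsTopologicalGroup G]
    {π : Representation R G V} (hπ : IsSmooth π) {χ : N →* Rˣ} (hχ : IsSmoothChar χ) (v : V) :
    IsOpen (vecStabilizer (twist π χ) v : Set N) := by
  refine Subgroup.isOpen_mono (H₁ := χ.ker ⊓ (vecStabilizer π v).subgroupOf N) ?_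
    (hχ.inter ((hπ v).preimage continuous_subtype_val))
  rintro n ⟨h1, h2⟩
  have h1' : χ n = 1 := h1
  have h2' : π n v = v := h2
  rw [mem_vecStabilizer, twist_apply, h1', h2', Units.val_one, one_smul]

theorem isSmoothChar_inv [TopologicalSpace G] {θ : N →* Rˣ} (hθ : IsSmoothChar θ) :
    IsSmoothChar θ⁻¹ := by
  have : θ⁻¹.ker = θ.ker := by
    ext n
    simp [MonoidHom.mem_ker]
  rwa [IsSmoothChar, this]

end Twist

/-! ### Finite orbits -/

section Orbit

variable {R : Type*} [Field R] {G : Type*} [Group G] {V : Type*} [AddCommGroup V] [Module R V]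

theorem relIndex_vecStabilizer_ne_zero_iff {π : Representation R G V} {J : Subgroup G} {v : V} :
    (vecStabilizer π v).relIndex J ≠ 0 ↔ ((fun j => π j v) '' (J : Set G)).Finite := by
  have hp : (vecStabilizer π v).subgroupOf J ≤ rightPeriods fun j : J => π j v := by
    intro u hu j
    have : π u v = v := hu
    simp [map_mul, this]
  constructor
  · intro h
    have : ((vecStabilizer π v).subgroupOf J).FiniteIndex := ⟨h⟩
    refine (Set.finite_range fun q : J ⧸ (vecStabilizer π v).subgroupOf J => π q.out v).subset ?_
    rintro _ ⟨j, hj, rfl⟩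
    exact ⟨((⟨j, hj⟩ : J) : J ⧸ (vecStabilizer π v).subgroupOf J),
      apply_out_eq (φ := fun j : J => π j v) hp ⟨j, hj⟩⟩
  · intro h
    have := h.to_subtype
    have hinj : Function.Injective fun q : J ⧸ (vecStabilizer π v).subgroupOf J =>
        (⟨π q.out v, _, q.out.2, rfl⟩ : ((fun j => π j v) '' (J : Set G) : Set V)) := by
      intro a b hab
      have hab' : π (a.out : J) v = π (b.out : J) v := congrArg Subtype.val hab
      rw [← QuotientGroup.out_eq' a, ← QuotientGroup.out_eq' b, QuotientGroup.eq,
        Subgroup.mem_subgroupOf, mem_vecStabilizer]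
      change π ((a.out : G)⁻¹ * b.out) v = v
      rw [map_mul, Module.End.mul_apply, ← hab', ← Module.End.mul_apply, ← map_mul,
        inv_mul_cancel, map_one, Module.End.one_apply]
    have := Finite.of_injective _ hinj
    exact (Subgroup.finiteIndex_of_finite_quotient
      (H := (vecStabilizer π v).subgroupOf J)).index_ne_zero

end Orbit

/-! ### Compactness modulo the center -/

section ModCenter

variable {G : Type*} [Group G] [TopologicalSpace G] [IsTopologicalGroup G] {N : Subgroup G}

/-- `N / (N ∩ Q)` embeds in the discrete space `G / Q`, where `Q` absorbs the center and the compact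
set `C * c⁻¹` has finite image. -/
theorem finite_image_quotient_of_mul_mem {C : Set G} {Q : Subgroup G} (hQ : IsOpen (Q : Set G))
    (hZ : Subgroup.center G ≤ Q) (hC : IsCompact C) (c : G) :
    ((↑) '' {n : N | (n : G) * c ∈ (Subgroup.center G : Set G) * C} :
      Set (N ⧸ Q.subgroupOf N)).Finite := by
  have := QuotientGroup.discreteTopology hQ
  have hfin : ((fun x : G => ((x * c⁻¹ : G) : G ⧸ Q)) '' C).Finite :=
    (hC.image (continuous_quotient_mk'.comp (continuous_mul_const _))).finite_of_discrete
  let ι : N ⧸ Q.subgroupOf N → G ⧸ Q := Quotient.map' Subtype.val fun a b hab => by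
    rw [QuotientGroup.leftRel_apply] at hab ⊢
    exact hab
  have hι : Function.Injective ι := by
    intro a b
    obtain ⟨a, rfl⟩ := QuotientGroup.mk_surjective a
    obtain ⟨b, rfl⟩ := QuotientGroup.mk_surjective b
    intro hab
    rw [QuotientGroup.eq, Subgroup.mem_subgroupOf]
    exact (QuotientGroup.eq (s := Q)).1 hab
  refine (hfin.preimage hι.injOn).subset ?_
  rintro _ ⟨n, ⟨z, hz, x, hx, hzx⟩, rfl⟩
  refine ⟨x, hx, ?_⟩
  change ((x * c⁻¹ : G) : G ⧸ Q) = ((n : G) : G ⧸ Q)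
  have hn : (n : G) = x * c⁻¹ * z := by
    rw [eq_comm, Subgroup.mem_center_iff.1 hz, ← mul_assoc]
    exact mul_inv_eq_of_eq_mul hzx
  rw [hn, QuotientGroup.eq, inv_mul_cancel_left]
  exact hZ hz

/-- A compact set is covered by finitely many left cosets of an open subgroup. -/
theorem exists_finset_subset_mul {C : Set G} (hC : IsCompact C) {J : Subgroup G}
    (hJ : IsOpen (J : Set G)) : ∃ s : Finset G, ∀ c ∈ C, ∃ a ∈ s, ∃ j ∈ J, c = a * j := by
  obtain ⟨s, hs⟩ := hC.elim_finite_subcover (fun a : G => (a * ·) '' (J : Set G))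
    (fun a => (isOpenMap_mul_left a) _ hJ)
    (fun c _ => Set.mem_iUnion.2 ⟨c, 1, J.one_mem, mul_one c⟩)
  refine ⟨s, fun c hc => ?_⟩
  obtain ⟨a, ha, j, hj, h⟩ := Set.mem_iUnion₂.1 (hs hc)
  exact ⟨a, ha, j, hj, h.symm⟩

end ModCenter

/-! ### The dimension inequality for a pairing -/

section Main

variable {R : Type*} [Field R] {G : Type*} [Group G] {N : Subgroup G}
  {V : Type*} [AddCommGroup V] [Module R V] {W : Type*} [AddCommGroup W] [Module R W]
  {π : Representation R G V} {τ : Representation R G W} {β : W →ₗ[R] V →ₗ[R] R}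
  {θ : N →* Rˣ}

theorem pairing_twist (hβ : ∀ g w v, β (τ g w) (π g v) = β w v) (n : N) (w : W) (v : V) :
    β (twist τ θ n w) (twist π θ⁻¹ n v) = β w v := by
  simp [twist_apply, hβ]

variable [TopologicalSpace G] [IsTopologicalGroup G] {𝓛 : Set (Subgroup N)}

/-- For n = zj the scalar by which `z` acts cancels θ(n)⁻¹, so `n` acts through `j` alone in the
twist. Orbits of N ∩ ZJ thus lie in orbits of the compact group `J`, which are finite. -/
theorem isIntegrable_twist (hcov : ∀ n : N, ∃ L ∈ 𝓛, n ∈ L)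
    (hpro : ∀ L ∈ 𝓛, HasInvertibleProOrder R L) (hθ : IsSmoothChar θ) (hπ : IsSmooth π)
    (hc : ∀ w v, IsCompactModCenter (Function.support fun g => β w (π g v)))
    {J : Subgroup G} (hJ : IsOpen (J : Set G)) (hJc : IsCompact (J : Set G))
    (hsc : ∀ n : N, ∀ z ∈ Subgroup.center G, ∀ j ∈ J, z * j = n → ∀ v, π z v = (θ n : R) • v) :
    IsIntegrable (twist π θ⁻¹) β ((Subgroup.center G ⊔ J).subgroupOf N) 𝓛 where
  cover := hcov
  proOrder := hpro
  isOpen := (Subgroup.isOpen_mono le_sup_right hJ).preimage continuous_subtype_val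
  smooth v := isOpen_vecStabilizer_twist hπ (isSmoothChar_inv hθ) v
  relIndex_ne_zero v := by
    refine relIndex_vecStabilizer_ne_zero_iff.2
      ((relIndex_vecStabilizer_ne_zero_iff.1 (relIndex_ne_zero_of_isOpen hJc (hπ v))).subset ?_)
    rintro _ ⟨n, hn, rfl⟩
    obtain ⟨z, hz, j, hj, hzj⟩ := Subgroup.mem_sup_of_normal_left.1 hn
    refine ⟨j, hj, ?_⟩
    have hzj' : z * j = n := hzj
    simp [twist_apply, ← hzj', hsc n z hz j hj hzj', smul_smul]
  finite_support w v := by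
    obtain ⟨C, hC, hs⟩ := hc w v
    refine (finite_image_quotient_of_mul_mem (Subgroup.isOpen_mono le_sup_right hJ) le_sup_left hC
      1).subset (Set.image_mono fun n hn => ?_)
    rw [Set.mem_ofPred_eq, mul_one]
    refine hs fun h0 => hn ?_
    simp [twist_apply, h0]

theorem homChar_apply_eq_zero [IsDirectedOrder 𝓛] [Nonempty 𝓛] {M : Subgroup N}
    (h : IsIntegrable (twist π θ⁻¹) β M 𝓛)
    (hM : ∀ (C : Set G), IsCompact C → ∀ c : G,
      ((↑) '' {n : N | (n : G) * c ∈ (Subgroup.center G : Set G) * C} : Set (N ⧸ M)).Finite)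
    (hθ : IsSmoothChar θ) (hπ : IsSmooth π) (hτ : IsSmooth τ)
    (hβ : ∀ g w v, β (τ g w) (π g v) = β w v)
    (hc : ∀ w v, IsCompactModCenter (Function.support fun g => β w (π g v)))
    {v₀ : V} (hv₀ : ∀ w, (∀ g, β w (π g v₀) = 0) → w = 0)
    {w : W} (hw : h.integral w = 0) (T : HomChar τ N θ⁻¹) : T w = 0 := by
  obtain ⟨C, hC, hs⟩ := hc w v₀
  obtain ⟨s, hsC⟩ := exists_finset_subset_mul hC (hπ v₀)
  have hβ' : ∀ z w v, β w (π z v) = β (τ z⁻¹ w) v := by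
    intro z w v
    rw [← hβ z (τ z⁻¹ w) v, ← Module.End.mul_apply, ← map_mul, mul_inv_cancel, map_one,
      Module.End.one_apply]
  have hcomm : ∀ z ∈ Subgroup.center G, ∀ (n : N) v,
      twist π θ⁻¹ n (π z v) = π z (twist π θ⁻¹ n v) := by
    intro z hz n v
    rw [twist_apply, twist_apply, map_smul, ← Module.End.mul_apply, ← Module.End.mul_apply,
      ← map_mul, ← map_mul, Subgroup.mem_center_iff.1 hz]
  have hmean : ∀ z ∈ Subgroup.center G, ∀ (L : Subgroup N) v,
      coeffMean (twist π θ⁻¹) β L w (π z v) = coeffMean (twist π θ⁻¹) β L (τ z⁻¹ w) v := by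
    intro z hz L v
    simp only [coeffMean, hcomm z hz, hβ']
  -- The kernel of the integral is stable under the center.
  have hint : ∀ z ∈ Subgroup.center G, ∀ v, h.integral (τ z⁻¹ w) v = 0 := by
    intro z hz v
    obtain ⟨L, h1, h2⟩ :=
      ((h.eventually_eq (τ z⁻¹ w) v).and (h.eventually_eq w (π z v))).exists
    rw [h.integral_apply, h1, ← hmean z hz, ← h2, ← h.integral_apply, hw, LinearMap.zero_apply]
  -- For fixed `a`, the coefficients of all the `τ z⁻¹ w` at `π a v₀` are supported where `n * a`
  -- lies in `Z * C`, a condition free of `z`; so one `L` serves the whole center.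
  have hev : ∀ᶠ L : 𝓛 in atTop, ∀ a ∈ s, ∀ z ∈ Subgroup.center G,
      coeffMean (twist π θ⁻¹) β L w (π (z * a) v₀) = 0 := by
    refine (eventually_all_finset s).2 fun a _ => ?_
    filter_upwards [h.eventually_coeffMean_eq_zero (π a v₀) (hM C hC a)] with L hL z hz
    rw [map_mul, Module.End.mul_apply, hmean z hz]
    refine hL _ (fun n hn => ?_) (hint z hz _)
    have h1 : β w (π (z * (n * a)) v₀) ≠ 0 := by
      intro h0
      refine hn ?_
      rw [← hβ', twist_apply, map_smul, map_smul, ← Module.End.mul_apply, ← Module.End.mul_apply,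
        ← map_mul, ← map_mul, mul_assoc, h0, smul_zero]
    obtain ⟨z', hz', x, hx, hzx⟩ := hs h1
    refine ⟨z⁻¹ * z', mul_mem (inv_mem hz) hz', x, hx, ?_⟩
    have hzx' : z' * x = z * (n * a) := hzx
    change z⁻¹ * z' * x = n * a
    rw [mul_assoc, hzx', inv_mul_cancel_left]
  obtain ⟨L, hL⟩ := hev.exists
  have hLp := h.proOrder L L.2
  -- Either the coefficient vanishes on `L g`, or some `l * g` has the form `z * a * j`, and
  -- invariance of the mean under `L` reduces `g` to `z * a`.
  have hzero : ∀ g, coeffMean (twist π θ⁻¹) β L w (π g v₀) = 0 := by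
    intro g
    by_contra hne
    have hex : ∃ l : (L : Subgroup N), β w (twist π θ⁻¹ (l : N) (π g v₀)) ≠ 0 := by
      by_contra! hall
      refine hne ?_
      rw [coeffMean, show (fun l : (L : Subgroup N) => β w (twist π θ⁻¹ (l : N) (π g v₀))) =
        fun _ => 0 from funext hall, groupMean_const]
    obtain ⟨l, hl⟩ := hex
    have hl' : β w (π ((l : N) * g) v₀) ≠ 0 := by
      intro h0
      refine hl ?_
      rw [twist_apply, map_smul, ← Module.End.mul_apply, ← map_mul, h0, smul_zero]
    obtain ⟨z, hz, x, hx, hzx⟩ := hs hl'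
    obtain ⟨a, ha, j, hj, rfl⟩ := hsC x hx
    refine hne ?_
    have hj' : π j v₀ = v₀ := hj
    have hzx' : z * (a * j) = (l : N) * g := hzx
    rw [← coeffMean_apply_right hLp (h.smooth _) l.2, twist_apply, ← Module.End.mul_apply,
      ← map_mul, ← hzx', coeffMean_smul_right hLp (h.smooth _), ← mul_assoc, map_mul,
      Module.End.mul_apply, hj', hL a ha z hz, mul_zero]
  have hσ := isOpen_vecStabilizer_twist hτ hθ w
  have hx : groupMean R (fun l : (L : Subgroup N) => twist τ θ l w) = 0 := by
    refine hv₀ _ fun g => ?_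
    rw [← coeffMean_eq_apply_groupMean hLp (pairing_twist hβ) (h.smooth _) hσ, hzero]
  have hp : (vecStabilizer (twist τ θ) w).subgroupOf L ≤
      rightPeriods fun l : (L : Subgroup N) => twist τ θ l w := by
    intro u hu l
    have : twist τ θ u w = w := hu
    simp [map_mul, this]
  have hT := map_groupMean T.toLinearMap (hLp.index_ne_zero hσ) hp
  rw [hx, map_zero] at hT
  rw [← hT, ← groupMean_const (R := R) (K := (L : Subgroup N)) (T w)]
  congr 1
  -- In `T (twist τ θ l w)` the factor θ(l) of the twist cancels the factor θ(l)⁻¹ from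
  -- equivariance.
  ext l
  rw [Representation.IntertwiningMap.toLinearMap_apply, twist_apply, map_smul, homChar_apply]
  simp

/-- If `V` and `W` are in duality and `V` is generated by `v₀`, then integration over `N` bounds the
dimension of the space of `θ⁻¹`-equivariant functionals on `W`. -/
theorem finrank_homChar_le [IsDirectedOrder 𝓛] [Nonempty 𝓛]
    (hcov : ∀ n : N, ∃ L ∈ 𝓛, n ∈ L)
    (hpro : ∀ L ∈ 𝓛, HasInvertibleProOrder R L) (hθ : IsSmoothChar θ)
    (hπ : IsSmooth π) (hτ : IsSmooth τ)
    (hβ : ∀ g w v, β (τ g w) (π g v) = β w v)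
    (hc : ∀ w v, IsCompactModCenter (Function.support fun g => β w (π g v)))
    {J : Subgroup G} (hJ : IsOpen (J : Set G)) (hJc : IsCompact (J : Set G))
    (hsc : ∀ n : N, ∀ z ∈ Subgroup.center G, ∀ j ∈ J, z * j = n → ∀ v, π z v = (θ n : R) • v)
    {v₀ : V} (hv₀ : ∀ w, (∀ g, β w (π g v₀) = 0) → w = 0)
    [FiniteDimensional R (HomChar π N θ)] :
    FiniteDimensional R (HomChar τ N θ⁻¹) ∧
      Module.finrank R (HomChar τ N θ⁻¹) ≤ Module.finrank R (HomChar π N θ) := by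
  have h := isIntegrable_twist (β := β) hcov hpro hθ hπ hc hJ hJc hsc
  let Φ : W →ₗ[R] HomChar π N θ :=
    { toFun := fun w => (h.integral w).intertwiningMap_of_isIntertwiningMap _ _ fun n v => by
        change h.integral w (π n v) = (θ n : R) * h.integral w v
        rw [apply_eq_smul_twist_inv π θ, map_smul, h.integral_apply_right, smul_eq_mul]
      map_add' := fun w w' => by
        ext v
        exact LinearMap.congr_fun (map_add h.integral w w') v
      map_smul' := fun c w => by
        ext v
        exact LinearMap.congr_fun (map_smul h.integral c w) v }
  have hker : ∀ T : HomChar τ N θ⁻¹, T.toLinearMap ∈ (LinearMap.ker Φ).dualAnnihilator := by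
    intro T
    rw [Submodule.mem_dualAnnihilator]
    intro w hw
    refine homChar_apply_eq_zero h (fun C hC c => finite_image_quotient_of_mul_mem
      (Subgroup.isOpen_mono le_sup_right hJ) le_sup_left hC c) hθ hπ hτ hβ hc hv₀ ?_ T
    ext v
    exact DFunLike.congr_fun (LinearMap.mem_ker.1 hw) v
  -- The annihilator of `ker Φ` is the dual of `W / ker Φ`, which is isomorphic to the range of `Φ`.
  let Ψ : HomChar τ N θ⁻¹ →ₗ[R] (LinearMap.ker Φ).dualAnnihilator :=
    LinearMap.codRestrict _
      (Representation.IntertwiningMap.toLinearMapl _ _ : HomChar τ N θ⁻¹ →ₗ[R] W →ₗ[R] R) hker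
  have hΨ : Function.Injective Ψ := fun S T hST =>
    Representation.IntertwiningMap.ext (congrArg Subtype.val hST)
  have e := (LinearMap.ker Φ).dualQuotEquivDualAnnihilator
  have e' := Φ.quotKerEquivRange
  have : Module.Finite R (W ⧸ LinearMap.ker Φ) := Module.Finite.equiv e'.symm
  have hinj : Function.Injective (e.symm.toLinearMap ∘ₗ Ψ) := e.symm.injective.comp hΨ
  refine ⟨Module.Finite.of_injective _ hinj, ?_⟩
  calc Module.finrank R (HomChar τ N θ⁻¹)
      ≤ Module.finrank R (Module.Dual R (W ⧸ LinearMap.ker Φ)) :=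
        LinearMap.finrank_le_finrank_of_injective hinj
    _ = Module.finrank R (W ⧸ LinearMap.ker Φ) := Subspace.dual_finrank_eq
    _ = Module.finrank R (LinearMap.range Φ) := e'.finrank_eq
    _ ≤ Module.finrank R (HomChar π N θ) := Submodule.finrank_le _

end Main

/-! ### Schur's lemma for central elements -/

section Irreducible

variable {R : Type*} [Field R] {G : Type*} [Group G] {V : Type*} [AddCommGroup V] [Module R V]
  {π : Representation R G V}

theorem mem_of_isIrreducible (hirr : π.IsIrreducible) {S : Submodule R V}
    (hS : ∀ g, ∀ v ∈ S, π g v ∈ S) {v : V} (hv : v ∈ S) (hv0 : v ≠ 0) (x : V) : x ∈ S := by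
  rcases hirr.eq_bot_or_eq_top (⟨S, fun g v h => hS g v h⟩ : Subrepresentation π) with h | h
  · have : S = ⊥ := congrArg Subrepresentation.toSubmodule h
    rw [this] at hv
    exact absurd hv hv0
  · have : S = ⊤ := congrArg Subrepresentation.toSubmodule h
    rw [this]
    trivial

theorem exists_ne_zero_of_isIrreducible (hirr : π.IsIrreducible) : ∃ v : V, v ≠ 0 := by
  by_contra! h
  refine hirr.toNontrivial.exists_pair_ne.elim fun S ⟨S', hS⟩ => hS ?_
  have : Subsingleton V := ⟨fun a b => by rw [h a, h b]⟩
  exact Subrepresentation.toSubmodule_injective (Subsingleton.elim _ _)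

/-- Split off a root c of p = (X - c) q: either q(f) already kills `v`, or q(f)v is an eigenvector.
No finiteness of `V` is needed. -/
theorem exists_eigenvector_of_aeval_eq_zero [IsAlgClosed R] (f : Module.End R V)
    (p : Polynomial R) (hp : p ≠ 0) {v : V} (hv : v ≠ 0) (h : Polynomial.aeval f p v = 0) :
    ∃ c : R, ∃ w : V, w ≠ 0 ∧ f w = c • w := by
  induction hd : p.natDegree generalizing p with
  | zero =>
    rw [Polynomial.eq_C_of_natDegree_eq_zero hd] at h hp
    rw [Polynomial.aeval_C, Module.algebraMap_end_apply] at h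
    rcases smul_eq_zero.1 h with h | h
    · exact absurd (by rw [h, Polynomial.C_0]) hp
    · exact absurd h hv
  | succ d ih =>
    obtain ⟨c, hc⟩ := IsAlgClosed.exists_root p fun h0 => by
      rw [Polynomial.natDegree_eq_zero_iff_degree_le_zero.2 h0.le] at hd
      omega
    obtain ⟨q, rfl⟩ := Polynomial.dvd_iff_isRoot.2 hc
    by_cases hq : Polynomial.aeval f q v = 0
    · refine ih q (right_ne_zero_of_mul hp) hq ?_
      rw [Polynomial.natDegree_mul (left_ne_zero_of_mul hp) (right_ne_zero_of_mul hp),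
        Polynomial.natDegree_X_sub_C] at hd
      omega
    · refine ⟨c, _, hq, ?_⟩
      rw [map_mul, Module.End.mul_apply] at h
      simpa [sub_eq_zero] using h

theorem eq_zero_of_apply_eq_zero (hirr : π.IsIrreducible) {f : V →ₗ[R] V}
    (hf : ∀ g v, f (π g v) = π g (f v)) {v : V} (hv : v ≠ 0) (h : f v = 0) (x : V) : f x = 0 :=
  LinearMap.mem_ker.1 (mem_of_isIrreducible hirr (S := LinearMap.ker f)
    (fun g v hv => by rw [LinearMap.mem_ker] at hv ⊢; rw [hf, hv, map_zero]) h hv x)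

/-- A power of a central element acting trivially on a nonzero vector forces the element to act by
a scalar. -/
theorem exists_scalar_of_pow_apply_eq [IsAlgClosed R] (hirr : π.IsIrreducible) {z : G}
    (hz : z ∈ Subgroup.center G) {m : ℕ} (hm : 0 < m) {v : V} (hv : v ≠ 0)
    (h : π (z ^ m) v = v) : ∃ c : R, ∀ x, π z x = c • x := by
  obtain ⟨c, w, hw, hc⟩ := exists_eigenvector_of_aeval_eq_zero (π z)
    (Polynomial.X ^ m - 1) (Polynomial.X_pow_sub_C_ne_zero hm 1) hv (by
      rw [map_sub, map_pow, Polynomial.aeval_X, map_one, ← map_pow, LinearMap.sub_apply, h,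
        Module.End.one_apply, sub_self])
  refine ⟨c, fun x => ?_⟩
  have := eq_zero_of_apply_eq_zero hirr (f := π z - c • LinearMap.id) (fun g v => ?_) hw
    (by simp [hc]) x
  · simpa [sub_eq_zero] using this
  · have hcomm : π z (π g v) = π g (π z v) := by
      rw [← Module.End.mul_apply, ← Module.End.mul_apply, ← map_mul, ← map_mul,
        Subgroup.mem_center_iff.1 hz]
    simp [hcomm]

end Irreducible

/-! ### The exhaustion, seen inside N -/

section Exhausted

variable {R : Type*} [Field R] {G : Type*} [Group G] [TopologicalSpace G]
  {N : Subgroup G}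

theorem HasInvertibleProOrder.subgroupOf {K : Subgroup G} (hK : HasInvertibleProOrder R K)
    (hle : K ≤ N) : HasInvertibleProOrder R (K.subgroupOf N) := by
  intro U hU
  let e := Subgroup.subgroupOfEquivOfLe hle
  have hcont : Continuous e.symm :=
    (continuous_subtype_val.subtype_mk _).subtype_mk _
  have := hK (U.comap e.symm.toMonoidHom) (hU.preimage hcont)
  rwa [Subgroup.index_comap_of_surjective _ e.symm.surjective] at this

theorem IsExhausted.exists_directed (h : IsExhausted R N) : ∃ 𝓛 : Set (Subgroup N),
    IsDirectedOrder 𝓛 ∧ Nonempty 𝓛 ∧ (∀ n : N, ∃ L ∈ 𝓛, n ∈ L) ∧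
      ∀ L ∈ 𝓛, HasInvertibleProOrder R L := by
  obtain ⟨𝓚, hdir, hK, hN⟩ := h
  have hle : ∀ K ∈ 𝓚, K ≤ N := fun K hKm x hx => by
    have : x ∈ (N : Set G) := hN ▸ Set.mem_biUnion hKm hx
    exact this
  have hcov : ∀ n : N, ∃ L ∈ (fun K => K.subgroupOf N) '' 𝓚, n ∈ L := by
    intro n
    have : (n : G) ∈ (N : Set G) := n.2
    rw [hN] at this
    obtain ⟨K, hKm, hn⟩ := Set.mem_iUnion₂.1 this
    exact ⟨_, ⟨K, hKm, rfl⟩, hn⟩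
  refine ⟨(fun K => K.subgroupOf N) '' 𝓚, ⟨?_⟩, ?_, hcov, ?_⟩
  · rintro ⟨_, K, hKm, rfl⟩ ⟨_, K', hKm', rfl⟩
    obtain ⟨K'', hKm'', h1, h2⟩ := hdir K hKm K' hKm'
    exact ⟨⟨_, K'', hKm'', rfl⟩, Subgroup.comap_mono h1, Subgroup.comap_mono h2⟩
  · obtain ⟨L, hL, -⟩ := hcov 1
    exact ⟨⟨L, hL⟩⟩
  · rintro _ ⟨K, hKm, rfl⟩
    exact (hK K hKm).2.subgroupOf (hle K hKm)

end Exhausted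

/-! ### The contragredient -/

section Contragredient

variable {R : Type*} [Field R] {G : Type*} [Group G] [TopologicalSpace G] [IsTopologicalGroup G]
  {V : Type*} [AddCommGroup V] [Module R V] {π : Representation R G V}

theorem contragredient_apply (g : G) (f : SmoothDual π) (v : V) :
    (contragredient π g f : Module.Dual R V) v = (f : Module.Dual R V) (π g⁻¹ v) := rfl

theorem isSmooth_contragredient : IsSmooth (R := R) (G := G) (V := SmoothDual π) (contragredient π) := by
  intro f
  have : vecStabilizer (V := SmoothDual π) (contragredient π) f = vecStabilizer π.dual f := by
    ext g
    exact Subtype.ext_iff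
  rw [this]
  exact f.2

/-- Smooth functionals separate points, for a group with an open subgroup of invertible
pro-order. -/
theorem exists_smoothDual_apply_ne_zero {K : Subgroup G} (hK : IsOpen (K : Set G))
    (hKp : HasInvertibleProOrder R K) (hsm : IsSmooth π) {v : V} (hv : v ≠ 0) :
    ∃ f : SmoothDual π, (f : Module.Dual R V) v ≠ 0 := by
  obtain ⟨φ, hφ⟩ : ∃ φ : Module.Dual R V, φ v ≠ 0 := by
    by_contra! h
    exact hv ((Module.forall_dual_apply_eq_zero_iff R v).1 h)
  have hU : IsOpen ((K ⊓ vecStabilizer π v : Subgroup G) : Set G) := hK.inter (hsm v)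
  have hUp := hKp.of_le_of_isOpen inf_le_left hU
  -- Averaging `φ` over an open group fixing `v` makes it smooth and keeps its value at `v`.
  let f : Module.Dual R V :=
    { toFun := coeffMean π LinearMap.id (K ⊓ vecStabilizer π v) φ
      map_add' := fun x y => coeffMean_add_right hUp (hsm x) (hsm y)
      map_smul' := fun c x => coeffMean_smul_right hUp (hsm x) c }
  have hf : IsOpen (vecStabilizer π.dual f : Set G) := by
    refine Subgroup.isOpen_mono (fun g hg => ?_) hU
    rw [mem_vecStabilizer]
    ext x
    exact coeffMean_apply_right hUp (hsm x) (inv_mem hg)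
  refine ⟨⟨f, hf⟩, ?_⟩
  have hconst : (fun u : (K ⊓ vecStabilizer π v : Subgroup G) => φ (π u v)) = fun _ => φ v := by
    ext u
    rw [show π u v = v from u.2.2]
  change groupMean R (fun u : (K ⊓ vecStabilizer π v : Subgroup G) => φ (π u v)) ≠ 0
  rwa [hconst, groupMean_const]

end Contragredient

/-! ### Central scalars and the two inequalities -/

section Dichotomy

variable {R : Type*} [Field R] {G : Type*} [Group G] [TopologicalSpace G]
  {V : Type*} [AddCommGroup V] [Module R V] {π : Representation R G V}
  {N : Subgroup G} {θ : N →* Rˣ}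

/-- A central element that is congruent modulo the stabilizer of a nonzero vector to an element of a
subgroup of invertible pro-order acts by a scalar. -/
theorem exists_scalar_of_mul_eq [IsAlgClosed R] (hirr : π.IsIrreducible) (hsm : IsSmooth π)
    (hcov : ∀ n : N, ∃ L : Subgroup N, HasInvertibleProOrder R L ∧ n ∈ L) {v : V} (hv : v ≠ 0)
    {n : N} {z j : G} (hz : z ∈ Subgroup.center G) (hj : π j v = v) (h : z * j = n) :
    ∃ c : R, ∀ x, π z x = c • x := by
  obtain ⟨L, hL, hn⟩ := hcov n
  have ho : IsOpen ((vecStabilizer π v).subgroupOf N : Set N) :=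
    (hsm v).preimage continuous_subtype_val
  -- Some positive power n^m = z^m j^m fixes `v`; so does j^m, hence also z^m.
  obtain ⟨m, hm, -, hnm⟩ := Subgroup.exists_pow_mem_of_relIndex_ne_zero
    (H := (vecStabilizer π v).subgroupOf N) (K := L)
    (finiteIndex_of_cast_ne_zero (hL.index_ne_zero ho)).index_ne_zero hn
  refine exists_scalar_of_pow_apply_eq hirr hz hm hv ?_
  have hnm' : (n : G) ^ m ∈ vecStabilizer π v := hnm.1
  have hcomm : Commute z j := (Subgroup.mem_center_iff.1 hz j).symm
  rw [← h, hcomm.mul_pow] at hnm'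
  exact (Subgroup.mul_mem_cancel_right _ (pow_mem (show j ∈ vecStabilizer π v from hj) m)).1 hnm'

/-- Take for `J` the stabilizer of `v`: then n = zj acts on `v` by `c`, so c T(v) = θ(n) T(v). -/
theorem subsingleton_homChar_of_forall_exists (hsm : IsSmooth π)
    (h : ∀ J : Subgroup G, IsOpen (J : Set G) → ∃ n : N, ∃ z ∈ Subgroup.center G, ∃ j ∈ J,
      z * j = n ∧ ∃ c : R, (∀ x, π z x = c • x) ∧ c ≠ θ n) :
    Subsingleton (HomChar π N θ) := by
  refine subsingleton_of_forall_eq 0 fun T => ?_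
  ext v
  obtain ⟨n, z, hz, j, hj, hzj, c, hc, hne⟩ := h _ (hsm v)
  have h1 := homChar_apply T n v
  have hj' : π j v = v := hj
  rw [← hzj, map_mul, Module.End.mul_apply, hj', hc, map_smul, smul_eq_mul] at h1
  by_contra h0
  exact hne (mul_right_cancel₀ h0 h1)

variable [IsTopologicalGroup G]

/-- If the central elements of `N J` act, for no open subgroup `J`, as prescribed by `θ`, then there
are no equivariant functionals on `π` or on its contragredient. -/
theorem subsingleton_homChar [IsAlgClosed R] (hirr : π.IsIrreducible) (hsm : IsSmooth π)
    (hcov : ∀ n : N, ∃ L : Subgroup N, HasInvertibleProOrder R L ∧ n ∈ L)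
    (h : ¬ ∃ J : Subgroup G, IsOpen (J : Set G) ∧ ∀ n : N, ∀ z ∈ Subgroup.center G, ∀ j ∈ J,
      z * j = n → ∀ v, π z v = (θ n : R) • v) :
    Subsingleton (HomChar π N θ) ∧ Subsingleton (HomChar (contragredient π) N θ⁻¹) := by
  obtain ⟨v₀, hv₀⟩ := exists_ne_zero_of_isIrreducible hirr
  have key : ∀ J : Subgroup G, IsOpen (J : Set G) → ∃ n : N, ∃ z ∈ Subgroup.center G, ∃ j ∈ J,
      z * j = n ∧ ∃ c : R, (∀ x, π z x = c • x) ∧ c ≠ θ n := by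
    intro J hJ
    push Not at h
    -- Shrinking `J` into the stabilizer of `v₀` ensures that `z` acts by a scalar.
    obtain ⟨n, z, hz, j, hj, hzj, x, hx⟩ := h (J ⊓ vecStabilizer π v₀) (hJ.inter (hsm v₀))
    obtain ⟨c, hc⟩ := exists_scalar_of_mul_eq hirr hsm hcov hv₀ hz hj.2 hzj
    refine ⟨n, z, hz, j, hj.1, hzj, c, hc, ?_⟩
    rintro rfl
    exact hx (hc x)
  refine ⟨subsingleton_homChar_of_forall_exists hsm key,
    subsingleton_homChar_of_forall_exists (V := SmoothDual π) isSmooth_contragredient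
      fun J hJ => ?_⟩
  obtain ⟨n, z, hz, j, hj, hzj, c, hc, hne⟩ := key J hJ
  have hc0 : c ≠ 0 := by
    rintro rfl
    refine hv₀ ?_
    rw [← π.inv_self_apply z v₀, hc, zero_smul, map_zero]
  refine ⟨n, z, hz, j, hj, hzj, c⁻¹, fun f => ?_, fun h => hne ?_⟩
  · ext x
    rw [contragredient_apply, show π z⁻¹ x = c⁻¹ • x by
      rw [Representation.inv_apply_eq_iff, hc, smul_smul, mul_inv_cancel₀ hc0, one_smul], map_smul]
    rfl
  · rw [MonoidHom.inv_apply, Units.val_inv_eq_inv_val] at h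
    exact inv_injective h

variable {𝓛 : Set (Subgroup N)} [IsDirectedOrder 𝓛] [Nonempty 𝓛]

theorem finrank_homChar_contragredient_le
    (hcov : ∀ n : N, ∃ L ∈ 𝓛, n ∈ L) (hpro : ∀ L ∈ 𝓛, HasInvertibleProOrder R L)
    (hθ : IsSmoothChar θ) (hirr : π.IsIrreducible) (hsm : IsSmooth π) (hZ : IsZCompact π)
    {J : Subgroup G} (hJ : IsOpen (J : Set G)) (hJc : IsCompact (J : Set G))
    (hsc : ∀ n : N, ∀ z ∈ Subgroup.center G, ∀ j ∈ J, z * j = n → ∀ v, π z v = (θ n : R) • v)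
    [FiniteDimensional R (HomChar π N θ)] :
    FiniteDimensional R (HomChar (contragredient π) N θ⁻¹) ∧
      Module.finrank R (HomChar (contragredient π) N θ⁻¹) ≤
        Module.finrank R (HomChar π N θ) := by
  obtain ⟨v₀, hv₀⟩ := exists_ne_zero_of_isIrreducible hirr
  let β : SmoothDual π →ₗ[R] V →ₗ[R] R := (smoothVectors π.dual).toSubmodule.subtype
  refine finrank_homChar_le (W := SmoothDual π) (τ := contragredient π)
    (β := β) hcov hpro hθ hsm isSmooth_contragredient (fun g f v => ?_)
    (fun f v => hZ f v) hJ hJc hsc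
    (v₀ := v₀) fun f hf => ?_
  · change (f : Module.Dual R V) (π g⁻¹ (π g v)) = (f : Module.Dual R V) v
    rw [π.inv_self_apply]
  · ext x
    -- The vectors whose orbit is killed by `f` form a subrepresentation, which contains `v₀`.
    have hx := mem_of_isIrreducible hirr
      (S := ⨅ g : G, LinearMap.ker ((f : Module.Dual R V) ∘ₗ π g)) (fun g v hv => ?_)
      (v := v₀) ((Submodule.mem_iInf _).2 fun g => hf g) hv₀ x
    · simpa using (Submodule.mem_iInf _).1 hx 1
    · refine (Submodule.mem_iInf _).2 fun g' => ?_
      have := (Submodule.mem_iInf _).1 hv (g' * g)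
      simpa using this

/-- The flipped pairing is used, with no irreducibility of π^∨: the vectors killed by the orbit of
`f₀` form a proper subrepresentation of π, as f₀(v₀) ≠ 0. -/
theorem finrank_homChar_le_contragredient
    (hcov : ∀ n : N, ∃ L ∈ 𝓛, n ∈ L) (hpro : ∀ L ∈ 𝓛, HasInvertibleProOrder R L)
    (hθ : IsSmoothChar θ) (hirr : π.IsIrreducible) (hsm : IsSmooth π) (hZ : IsZCompact π)
    {K : Subgroup G} (hK : IsOpen (K : Set G)) (hKp : HasInvertibleProOrder R K)
    {J : Subgroup G} (hJ : IsOpen (J : Set G)) (hJc : IsCompact (J : Set G))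
    (hsc : ∀ n : N, ∀ z ∈ Subgroup.center G, ∀ j ∈ J, z * j = n → ∀ v, π z v = (θ n : R) • v)
    [FiniteDimensional R (HomChar (contragredient π) N θ⁻¹)] :
    FiniteDimensional R (HomChar π N θ) ∧ Module.finrank R (HomChar π N θ) ≤
      Module.finrank R (HomChar (contragredient π) N θ⁻¹) := by
  obtain ⟨v₀, hv₀⟩ := exists_ne_zero_of_isIrreducible hirr
  obtain ⟨f₀, hf₀⟩ := exists_smoothDual_apply_ne_zero hK hKp hsm hv₀
  let β : SmoothDual π →ₗ[R] V →ₗ[R] R := (smoothVectors π.dual).toSubmodule.subtype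
  have h := finrank_homChar_le (V := SmoothDual π) (π := contragredient π) (τ := π)
    (β := β.flip) (θ := θ⁻¹) hcov hpro (isSmoothChar_inv hθ) isSmooth_contragredient hsm
    (fun g v f => ?_) (fun v f => ?_) hJ hJc (fun n z hz j hj hzj f => ?_)
    (v₀ := f₀) fun v hv => ?_
  · have hinv : θ⁻¹⁻¹ = θ := by
      ext n
      simp
    rwa [hinv] at h
  · change (f : Module.Dual R V) (π g⁻¹ (π g v)) = (f : Module.Dual R V) v
    rw [π.inv_self_apply]
  -- Coefficients of π^∨ are those of π at g⁻¹, so supports are inverted.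
  · obtain ⟨C, hC, hs⟩ := hZ f v
    refine ⟨C⁻¹, hC.inv, fun g hg => ?_⟩
    obtain ⟨z, hz, x, hx, hzx⟩ := hs (show g⁻¹ ∈ _ from hg)
    refine ⟨z⁻¹, inv_mem hz, x⁻¹, Set.inv_mem_inv.2 hx, ?_⟩
    have hzx' : z * x = g⁻¹ := hzx
    change z⁻¹ * x⁻¹ = g
    rw [← inv_inv g, ← hzx', mul_inv_rev, Subgroup.mem_center_iff.1 (inv_mem hz)]
  · ext x
    rw [contragredient_apply, show π z⁻¹ x = ((θ n)⁻¹ : Rˣ) • x by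
      rw [Representation.inv_apply_eq_iff, hsc n z hz j hj hzj, Units.smul_def, smul_smul,
        Units.mul_inv, one_smul], Units.smul_def, map_smul]
    rfl
  · by_contra hv0
    have hx := mem_of_isIrreducible hirr
      (S := ⨅ g : G, LinearMap.ker ((f₀ : Module.Dual R V) ∘ₗ π g)) (fun g v hv => ?_)
      (v := v) ((Submodule.mem_iInf _).2 fun g => ?_) hv0 v₀
    · exact hf₀ (by simpa using (Submodule.mem_iInf _).1 hx 1)
    · refine (Submodule.mem_iInf _).2 fun g' => ?_
      have := (Submodule.mem_iInf _).1 hv (g' * g)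
      simpa using this
    · have := hv g⁻¹
      change (f₀ : Module.Dual R V) (π g⁻¹⁻¹ v) = 0 at this
      rwa [inv_inv] at this

end Dichotomy

end LocProf

theorem theorem3p2
    {R : Type*} [Field R] [IsAlgClosed R]
    -- a locally profinite group with a compact open subgroup of invertible pro-order
    {G : Type*} [Group G] [TopologicalSpace G] [IsTopologicalGroup G]
    [T2Space G] [LocallyCompactSpace G] [TotallyDisconnectedSpace G]
    (hG : ∃ K : Subgroup G, IsOpen (K : Set G) ∧ IsCompact (K : Set G) ∧
      LocProf.HasInvertibleProOrder R K)
    -- a closed subgroup exhausted by compact subgroups, with a smooth character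
    (N : Subgroup G) (hN : IsClosed (N : Set G)) (hNex : LocProf.IsExhausted R N)
    (θ : N →* Rˣ) (hθ : LocProf.IsSmoothChar θ)
    -- an irreducible smooth representation with coefficients compact modulo the center
    {V : Type*} [AddCommGroup V] [Module R V] (π : Representation R G V)
    (hirr : π.IsIrreducible) (hsm : LocProf.IsSmooth π) (hZ : LocProf.IsZCompact π) :
    (FiniteDimensional R (LocProf.HomChar (LocProf.contragredient π) N θ⁻¹) ↔
      FiniteDimensional R (LocProf.HomChar π N θ)) ∧
    (FiniteDimensional R (LocProf.HomChar π N θ) →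
      Module.finrank R (LocProf.HomChar (LocProf.contragredient π) N θ⁻¹) =
        Module.finrank R (LocProf.HomChar π N θ)) := by
  obtain ⟨K, hKo, hKc, hKp⟩ := hG
  obtain ⟨𝓛, hdir, hne, hcov, hpro⟩ := hNex.exists_directed
  by_cases hJ : ∃ J : Subgroup G, IsOpen (J : Set G) ∧ ∀ n : N, ∀ z ∈ Subgroup.center G,
      ∀ j ∈ J, z * j = n → ∀ v, π z v = (θ n : R) • v
  · obtain ⟨J, hJo, hJ⟩ := hJ
    -- The scalar condition passes to smaller subgroups, so `J` may be made compact.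
    have hJKo : IsOpen ((K ⊓ J : Subgroup G) : Set G) := hKo.inter hJo
    have hJKc : IsCompact ((K ⊓ J : Subgroup G) : Set G) :=
      hKc.inter_right (Subgroup.isClosed_of_isOpen _ hJo)
    have hsc : ∀ n : N, ∀ z ∈ Subgroup.center G, ∀ j ∈ K ⊓ J, z * j = n →
        ∀ v, π z v = (θ n : R) • v := fun n z hz j hj => hJ n z hz j hj.2
    refine ⟨⟨fun _ => (LocProf.finrank_homChar_le_contragredient hcov hpro hθ hirr hsm hZ hKo hKp
        hJKo hJKc hsc).1,
      fun _ => (LocProf.finrank_homChar_contragredient_le hcov hpro hθ hirr hsm hZ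
        hJKo hJKc hsc).1⟩, fun _ => ?_⟩
    obtain ⟨_, h⟩ := LocProf.finrank_homChar_contragredient_le hcov hpro hθ hirr hsm hZ hJKo hJKc hsc
    exact h.antisymm (LocProf.finrank_homChar_le_contragredient hcov hpro hθ hirr hsm hZ hKo hKp
      hJKo hJKc hsc).2
  · obtain ⟨_, _⟩ := LocProf.subsingleton_homChar hirr hsm
      (fun n => (hcov n).imp fun L hL => ⟨hpro L hL.1, hL.2⟩) hJ
    exact ⟨⟨fun _ => inferInstance, fun _ => inferInstance⟩, fun _ => by
      rw [Module.finrank_zero_of_subsingleton, Module.finrank_zero_of_subsingleton]⟩
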